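/- Let $n$ be the dimension, let $\beta > n$ be real, let $\Omega \subset \mathbb{R}^n$ be an open convex set, and let $V : \Omega \to (0,\infty)$ be a convex differentiable function with $\int_\Omega V(x)^{-\beta}\,dx = 1$. Let $\mu$ be the probability measure concentrated on $\Omega$ with density $V^{-\beta}$ with respect to Lebesgue measure on $\Omega$, and put $$d_V(x,y) = V(y) - V(x) - \langle V'(x),\, y - x\rangle, \qquad x, y \in \Omega,$$ where $V'(x)$ denotes the gradient of $V$ at $x$. Let $f, g : \Omega \to \mathbb{R}$ be measurable functions such that $$f(x)V(x) \le g(y)V(y) + d_V(x,y) \qquad \text{for all } x, y \in \Omega .$$ If $f$ is $\mu$-integrable and $g \ge -1$ on $\Omega$, then $$1 + \frac{\beta}{\beta - n}\int f\,d\mu \;\le\; \left[\int (1+g)^{-\beta}\,d\mu\right]^{-1/(\beta-n)} .$$ Here the integral on the right is taken in $(0,+\infty]$, with $(1+g)^{-\beta} = +\infty$ where $g = -1$; if it equals $+\infty$, the right-hand side is $0$. -/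

import Mathlib

open MeasureTheory
open scoped ENNReal

/-- The distance-like cost function `d_V(x, y) = V(y) - V(x) - ⟨V'(x), y - x⟩` associated with a
differentiable function `V` on (an open subset of) `ℝⁿ`; `V'(x)` is the gradient. -/
noncomputable def convexCost {n : ℕ} (V : EuclideanSpace ℝ (Fin n) → ℝ)
    (x y : EuclideanSpace ℝ (Fin n)) : ℝ :=
  V y - V x - inner ℝ (gradient V x) (y - x)

/-- The measure concentrated on `Ω ⊆ ℝⁿ` with density `V ^ (-β)` with respect to Lebesgue
measure on `Ω`. -/
noncomputable def powerDensityMeasure {n : ℕ} (Ω : Set (EuclideanSpace ℝ (Fin n)))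
    (V : EuclideanSpace ℝ (Fin n) → ℝ) (β : ℝ) : Measure (EuclideanSpace ℝ (Fin n)) :=
  (volume.restrict Ω).withDensity fun x => ENNReal.ofReal (V x ^ (-β))

/-!
The inequality is the derivative at `t = 0` of a Borell–Brascamp–Lieb inequality. Put
`B = (1 + g) V` and `W = V (1 + t f)`. The hypothesis on `f` and `g` says that
`B(y) ≥ V(z) + f(z) V(z) + ⟨V'(z), y - z⟩`, and convexity says that
`V(x) ≥ V(z) + ⟨V'(z), x - z⟩`. For `z = (1 - t) x + t y` the gradient terms cancel in the convex
combination, which leaves `W(z) ≤ (1 - t) V(x) + t B(y)`. The Borell–Brascamp–Lieb inequality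
(`lintegral_rpow_le_euclideanSpace`) then yields

`(∫ (1 + t f) ^ (-β) dμ) ^ (-1 / (β - n)) ≤ (1 - t) + t (∫ (1 + g) ^ (-β) dμ) ^ (-1 / (β - n))`,

with equality at `t = 0`. Comparing right derivatives at `t = 0`
(`one_add_mul_integral_le_of_lintegral_rpow_le`) gives the theorem when `f` is bounded below.

To reduce to that case, the variable `y` is confined to a sublevel set `{V ≤ j}`. As `V` is bounded
below by some `m > 0` (`ConvexOn.exists_pos_le_of_setLIntegral_ne_top`) and `g ≥ -1`, the hypothesis
is then preserved when `f` is replaced by `max f (-k)` with `k ≥ j / m`. This only increases the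
integral of `f`, and letting `j → ∞` recovers the full integral of `(1 + g) ^ (-β)` by monotone
convergence.

The Borell–Brascamp–Lieb inequality is proved by induction on the dimension. On the line it follows
from the Brunn–Minkowski inequality for superlevel sets
(`Real.volume_add_volume_le_of_add_subset`) after each function is divided by its supremum;
Hölder's inequality then removes the suprema.
-/

/-! ### The Brunn–Minkowski inequality on the line -/

/-- The one-dimensional Brunn–Minkowski inequality. For compact `K ⊆ A` and `L ⊆ B`, the translates
`K + min L` and `max K + L` meet in at most one point and both lie in `A + B`. A point of `A` is
adjoined to `K`, and one of `B` to `L`, so that the maximum and the minimum exist. -/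
theorem Real.volume_add_volume_le_of_add_subset {A B C : Set ℝ} (hA : MeasurableSet A)
    (hB : MeasurableSet B) (hA' : A.Nonempty) (hB' : B.Nonempty)
    (hC : ∀ x ∈ A, ∀ y ∈ B, x + y ∈ C) : volume A + volume B ≤ volume C := by
  obtain ⟨a₀, ha₀⟩ := hA'
  obtain ⟨b₀, hb₀⟩ := hB'
  have key : ∀ K, K ⊆ A → IsCompact K → ∀ L, L ⊆ B → IsCompact L →
      volume K + volume L ≤ volume C := by
    intro K hKA hK L hLB hL
    obtain ⟨p, hpK, hp⟩ := (hK.insert a₀).exists_isGreatest (Set.insert_nonempty _ _)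
    obtain ⟨q, hqL, hq⟩ := (hL.insert b₀).exists_isLeast (Set.insert_nonempty _ _)
    have hK' : insert a₀ K ⊆ A := Set.insert_subset ha₀ hKA
    have hL' : insert b₀ L ⊆ B := Set.insert_subset hb₀ hLB
    have hdisj : Disjoint ((· + q) '' K) ((p + ·) '' (L \ {q})) := by
      rw [Set.disjoint_left]
      rintro _ ⟨x, hx, rfl⟩ ⟨y, ⟨hy, hyq⟩, hxy⟩
      have h1 : x ≤ p := hp (Set.mem_insert_of_mem _ hx)
      have h2 : q ≤ y := hq (Set.mem_insert_of_mem _ hy)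
      have h3 : y ≠ q := hyq
      have h4 : p + y = x + q := hxy
      exact h3 (by linarith)
    have hm : MeasurableSet ((· + q) '' K) :=
      (hK.image (continuous_id.add continuous_const)).isClosed.measurableSet
    calc volume K + volume L = volume K + volume (L \ {q}) := by
          rw [measure_sdiff_null (Real.volume_singleton)]
      _ = volume ((· + q) '' K) + volume ((p + ·) '' (L \ {q})) := by
          rw [Set.image_add_right, measure_preimage_add_right, Set.image_add_left,
            measure_preimage_add]
      _ = volume ((· + q) '' K ∪ (p + ·) '' (L \ {q})) := (measure_union' hdisj hm).symm
      _ ≤ volume C := by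
          refine measure_mono (Set.union_subset ?_ ?_)
          · rintro _ ⟨x, hx, rfl⟩
            exact hC x (hKA hx) q (hL' hqL)
          · rintro _ ⟨y, hy, rfl⟩
            exact hC p (hK' hpK) y (hLB hy.1)
  rw [hA.measure_eq_iSup_isCompact, hB.measure_eq_iSup_isCompact]
  simp only [iSup_and']
  refine ENNReal.biSup_add_biSup_le' ⟨∅, by simp⟩ ⟨∅, by simp⟩ ?_
  rintro K ⟨h1, h2⟩ L ⟨h3, h4⟩
  exact key K h1 h2 L h3 h4

theorem Real.ofReal_mul_volume_add_le {A B C : Set ℝ} (hA : MeasurableSet A)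
    (hB : MeasurableSet B) (hA' : A.Nonempty) (hB' : B.Nonempty) {a b : ℝ} (ha : 0 < a)
    (hb : 0 < b) (hC : ∀ x ∈ A, ∀ y ∈ B, a * x + b * y ∈ C) :
    ENNReal.ofReal a * volume A + ENNReal.ofReal b * volume B ≤ volume C := by
  have h := Real.volume_add_volume_le_of_add_subset (C := C) (hA.const_smul₀ a)
    (hB.const_smul₀ b) hA'.smul_set hB'.smul_set (by
      rintro _ ⟨x, hx, rfl⟩ _ ⟨y, hy, rfl⟩
      exact hC x hx y hy)
  simpa [Measure.addHaar_smul, abs_of_pos ha, abs_of_pos hb] using h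

/-! ### The one-dimensional functional inequality -/

theorem lintegral_eq_lintegral_volume_lt_of_le_one {w : ℝ → ℝ≥0∞} (hw : Measurable w)
    (hw1 : ∀ x, w x ≤ 1) :
    ∫⁻ x, w x = ∫⁻ t in Set.Ioi (0 : ℝ), volume {x | ENNReal.ofReal t < w x} := by
  have hfin : ∀ x, w x ≠ ∞ := fun x => ((hw1 x).trans_lt ENNReal.one_lt_top).ne
  have h := lintegral_eq_lintegral_meas_lt (volume : Measure ℝ) (f := fun x => (w x).toReal)
    (Filter.Eventually.of_forall fun x => ENNReal.toReal_nonneg) hw.ennreal_toReal.aemeasurable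
  simp only [ENNReal.ofReal_toReal (hfin _)] at h
  rw [h]
  refine setLIntegral_congr_fun measurableSet_Ioi fun t ht => ?_
  congr 1
  ext x
  exact (ENNReal.ofReal_lt_iff_lt_toReal (le_of_lt ht) (hfin x)).symm

/-- The Prékopa–Leindler inequality on the line for functions of supremum one. Since the suprema
agree, the superlevel sets of `u` and `v` are nonempty at the same levels, and the Brunn–Minkowski
inequality can be integrated over all levels. -/
theorem lintegral_add_lintegral_le_of_min_le {u v h : ℝ → ℝ≥0∞} (hu : Measurable u)
    (hv : Measurable v) (hh : Measurable h) (hu1 : ∀ x, u x ≤ 1) (hv1 : ∀ x, v x ≤ 1)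
    (hu2 : ∀ s < 1, ∃ x, s < u x) (hv2 : ∀ s < 1, ∃ x, s < v x) {a b : ℝ} (ha : 0 < a)
    (hb : 0 < b) (H : ∀ x y, min (u x) (v y) ≤ h (a * x + b * y)) :
    ENNReal.ofReal a * (∫⁻ x, u x) + ENNReal.ofReal b * (∫⁻ x, v x) ≤ ∫⁻ x, h x := by
  have hm : Measurable fun x => min (h x) 1 := hh.min measurable_const
  calc ENNReal.ofReal a * (∫⁻ x, u x) + ENNReal.ofReal b * (∫⁻ x, v x)
      ≤ ∫⁻ x, min (h x) 1 := ?_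
    _ ≤ ∫⁻ x, h x := lintegral_mono fun x => min_le_left _ _
  rw [lintegral_eq_lintegral_volume_lt_of_le_one hu hu1,
    lintegral_eq_lintegral_volume_lt_of_le_one hv hv1,
    lintegral_eq_lintegral_volume_lt_of_le_one hm fun x => min_le_right _ _,
    ← lintegral_const_mul' _ _ ENNReal.ofReal_ne_top,
    ← lintegral_const_mul' _ _ ENNReal.ofReal_ne_top, ← lintegral_add_left]
  · refine setLIntegral_mono' measurableSet_Ioi fun t _ => ?_
    rcases lt_or_ge (ENNReal.ofReal t) 1 with ht | ht
    · refine Real.ofReal_mul_volume_add_le (measurableSet_lt measurable_const hu)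
        (measurableSet_lt measurable_const hv) (hu2 _ ht) (hv2 _ ht) ha hb ?_
      intro x hx y hy
      exact lt_min ((lt_min hx hy).trans_le (H x y)) ht
    · have e : ∀ w : ℝ → ℝ≥0∞, (∀ x, w x ≤ 1) → {x | ENNReal.ofReal t < w x} = ∅ := by
        intro w hw
        ext x
        simpa using (hw x).trans ht
      simp [e u hu1, e v hv1]
  · refine Measurable.const_mul (Antitone.measurable fun s t hst => measure_mono ?_) _
    intro x hx
    exact (ENNReal.ofReal_le_ofReal hst).trans_lt hx

theorem ENNReal.rpow_le_rpow_of_nonpos {x y : ℝ≥0∞} {z : ℝ} (hz : z ≤ 0) (h : x ≤ y) :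
    y ^ z ≤ x ^ z := by
  rw [← neg_neg z, ENNReal.rpow_neg y, ENNReal.rpow_neg x, ENNReal.inv_le_inv]
  exact ENNReal.rpow_le_rpow h (neg_nonneg.2 hz)

/-- Hölder's inequality with exponents `β` and `β / (β - 1)`, in the form that removes the suprema
`P`, `Q` from the one-dimensional estimate. -/
theorem ENNReal.add_mul_rpow_neg_le {β : ℝ} (hβ : 1 < β) {A B P Q U V : ℝ≥0∞} (hA : A ≠ 0)
    (hA' : A ≠ ∞) (hB : B ≠ 0) (hB' : B ≠ ∞) (hU : U ≠ 0) (hU' : U ≠ ∞) (hV : V ≠ 0)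
    (hV' : V ≠ ∞) (hP : P ≠ 0) (hP' : P ≠ ∞) (hQ : Q ≠ 0) (hQ' : Q ≠ ∞) :
    (A * P ^ (-1 / β) + B * Q ^ (-1 / β)) ^ β ≤
      (A * (U / P) + B * (V / Q)) *
        (A * U ^ (-1 / (β - 1)) + B * V ^ (-1 / (β - 1))) ^ (β - 1) := by
  have hβ0 : 0 < β := by linarith
  have hβ1 : 0 < β - 1 := by linarith
  have hc : β.HolderConjugate (β / (β - 1)) := Real.HolderConjugate.conjExponent hβ
  have h := ENNReal.inner_le_Lp_mul_Lq (Finset.univ : Finset (Fin 2))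
    ![(A * (U / P)) ^ (1 / β), (B * (V / Q)) ^ (1 / β)]
    ![(A * U ^ (-1 / (β - 1))) ^ ((β - 1) / β), (B * V ^ (-1 / (β - 1))) ^ ((β - 1) / β)] hc
  simp only [Fin.sum_univ_two, Matrix.cons_val_zero, Matrix.cons_val_one, ← ENNReal.rpow_mul]
    at h
  have e1 : 1 / β * β = 1 := by field_simp
  have e2 : (β - 1) / β * (β / (β - 1)) = 1 := by field_simp
  have e3 : 1 / (β / (β - 1)) = (β - 1) / β := by field_simp
  have key : ∀ A P U : ℝ≥0∞, A ≠ 0 → A ≠ ∞ → P ≠ 0 → P ≠ ∞ → U ≠ 0 → U ≠ ∞ →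
      (A * (U / P)) ^ (1 / β) * (A * U ^ (-1 / (β - 1))) ^ ((β - 1) / β) =
        A * P ^ (-1 / β) := by
    intro A P U hA hA' hP hP' hU hU'
    have hUr : U ^ (-1 / (β - 1)) ≠ ∞ := ENNReal.rpow_ne_top_of_ne_zero hU hU'
    rw [ENNReal.mul_rpow_of_ne_top hA' (ENNReal.div_ne_top hU' hP), div_eq_mul_inv U P,
      ENNReal.mul_rpow_of_ne_top hU' (ENNReal.inv_ne_top.2 hP),
      ENNReal.mul_rpow_of_ne_top hA' hUr, ← ENNReal.rpow_mul, ENNReal.inv_rpow,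
      ← ENNReal.rpow_neg]
    have e4 : -1 / (β - 1) * ((β - 1) / β) = -1 / β := by field_simp
    have e5 : -(1 / β) = -1 / β := by ring
    rw [e4, e5]
    calc _ = (A ^ (1 / β) * A ^ ((β - 1) / β)) * (U ^ (1 / β) * U ^ (-1 / β)) * P ^ (-1 / β) := by
          ring
      _ = _ := by
          rw [← ENNReal.rpow_add _ _ hA hA', ← ENNReal.rpow_add _ _ hU hU']
          have e6 : 1 / β + (β - 1) / β = 1 := by field_simp; ring
          have e7 : 1 / β + -1 / β = 0 := by ring
          rw [e6, e7, ENNReal.rpow_one, ENNReal.rpow_zero, mul_one]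
  rw [key A P U hA hA' hP hP' hU hU', key B Q V hB hB' hQ hQ' hV hV', e1, e2, e3] at h
  simp only [ENNReal.rpow_one] at h
  calc _ ≤ _ := ENNReal.rpow_le_rpow h hβ0.le
    _ = _ := by
      rw [ENNReal.mul_rpow_of_nonneg _ _ hβ0.le, ← ENNReal.rpow_mul, ← ENNReal.rpow_mul, e1,
        ENNReal.rpow_one]
      congr 2
      field_simp

/-- The one-dimensional Borell–Brascamp–Lieb inequality for bounded functions `u`, `v` of finite
integral. -/
theorem lintegral_rpow_le_of_bounded {β : ℝ} (hβ : 1 < β) {a b : ℝ} (ha : 0 < a) (hb : 0 < b)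
    {u v h : ℝ → ℝ≥0∞} (hu : Measurable u) (hv : Measurable v) (hh : Measurable h)
    (hu1 : ⨆ x, u x ≠ ∞) (hv1 : ⨆ x, v x ≠ ∞)
    (hu2 : ∫⁻ x, u x ≠ ∞) (hv2 : ∫⁻ x, v x ≠ ∞)
    (H : ∀ x y, h (a * x + b * y) ^ (-1 / β) ≤
      ENNReal.ofReal a * u x ^ (-1 / β) + ENNReal.ofReal b * v y ^ (-1 / β)) :
    (∫⁻ x, h x) ^ (-1 / (β - 1)) ≤ ENNReal.ofReal a * (∫⁻ x, u x) ^ (-1 / (β - 1)) +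
      ENNReal.ofReal b * (∫⁻ x, v x) ^ (-1 / (β - 1)) := by
  have hβ0 : 0 < β := by linarith
  have hβ1 : 0 < β - 1 := by linarith
  have hneg : -1 / β < 0 := div_neg_of_neg_of_pos (by norm_num) hβ0
  have hneg' : -1 / (β - 1) < 0 := div_neg_of_neg_of_pos (by norm_num) hβ1
  have hA : ENNReal.ofReal a ≠ 0 := by simpa using ha
  have hB : ENNReal.ofReal b ≠ 0 := by simpa using hb
  have hA' : ENNReal.ofReal a ≠ ∞ := ENNReal.ofReal_ne_top
  have hB' : ENNReal.ofReal b ≠ ∞ := ENNReal.ofReal_ne_top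
  rcases eq_or_ne (∫⁻ x, u x) 0 with hU | hU
  · simp [hU, ENNReal.zero_rpow_of_neg hneg', ENNReal.mul_top hA]
  rcases eq_or_ne (∫⁻ x, v x) 0 with hV | hV
  · simp [hV, ENNReal.zero_rpow_of_neg hneg', ENNReal.mul_top hB]
  set P := ⨆ x, u x with hPdef
  set Q := ⨆ x, v x with hQdef
  have hP : P ≠ 0 := by
    intro h0
    apply hU
    have : ∀ x, u x = 0 := fun x => le_antisymm (h0 ▸ le_iSup u x) bot_le
    simp [this]
  have hQ : Q ≠ 0 := by
    intro h0
    apply hV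
    have : ∀ x, v x = 0 := fun x => le_antisymm (h0 ▸ le_iSup v x) bot_le
    simp [this]
  set A := ENNReal.ofReal a with hAdef
  set B := ENNReal.ofReal b with hBdef
  set c := A * P ^ (-1 / β) + B * Q ^ (-1 / β) with hc
  set D := A * (∫⁻ x, u x) ^ (-1 / (β - 1)) + B * (∫⁻ x, v x) ^ (-1 / (β - 1)) with hD
  have hPp : P ^ (-1 / β) ≠ ∞ := ENNReal.rpow_ne_top_of_ne_zero hP hu1
  have hQp : Q ^ (-1 / β) ≠ ∞ := ENNReal.rpow_ne_top_of_ne_zero hQ hv1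
  have hPp0 : P ^ (-1 / β) ≠ 0 := (ENNReal.rpow_pos (pos_iff_ne_zero.2 hP) hu1).ne'
  have hc0 : c ≠ 0 := by
    intro h0
    exact mul_ne_zero hA hPp0 (add_eq_zero.1 h0).1
  have hct : c ≠ ∞ := ENNReal.add_ne_top.2 ⟨ENNReal.mul_ne_top hA' hPp, ENNReal.mul_ne_top hB' hQp⟩
  have hcβ0 : c ^ β ≠ 0 := (ENNReal.rpow_pos (pos_iff_ne_zero.2 hc0) hct).ne'
  have hcβt : c ^ β ≠ ∞ := ENNReal.rpow_ne_top_of_ne_zero hc0 hct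
  have hsup : ∀ (w : ℝ → ℝ≥0∞), (⨆ x, w x) ≠ 0 → (⨆ x, w x) ≠ ∞ →
      ∀ s < 1, ∃ x, s < w x / ⨆ x, w x := by
    intro w h0 ht s hs
    have h1 : s * (⨆ x, w x) < ⨆ x, w x := by
      simpa using (ENNReal.mul_lt_mul_iff_left h0 ht).2 hs
    obtain ⟨x, hx⟩ := lt_iSup_iff.1 h1
    exact ⟨x, (ENNReal.lt_div_iff_mul_lt (Or.inl h0) (Or.inl ht)).2 hx⟩
  -- Rescaling each function by its supremum turns the power-mean hypothesis into `min ≤`.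
  have key := lintegral_add_lintegral_le_of_min_le (u := fun x => u x / P) (v := fun x => v x / Q)
    (h := fun x => c ^ β * h x) (hu.div_const P) (hv.div_const Q) (hh.const_mul _)
    (fun x => ENNReal.div_le_of_le_mul (by simpa using le_iSup u x))
    (fun x => ENNReal.div_le_of_le_mul (by simpa using le_iSup v x))
    (hsup u hP hu1) (hsup v hQ hv1) ha hb (by
      intro x y
      set m := min (u x / P) (v y / Q) with hm
      rcases eq_or_ne m 0 with hm0 | hm0
      · simp [hm0]
      have hmP : m ≤ u x / P := min_le_left _ _
      have hmQ : m ≤ v y / Q := min_le_right _ _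
      have hmt : m ≠ ∞ := by
        have : u x / P ≤ 1 := ENNReal.div_le_of_le_mul (by simpa using le_iSup u x)
        exact ((hmP.trans this).trans_lt ENNReal.one_lt_top).ne
      have hux : u x ^ (-1 / β) ≤ m ^ (-1 / β) * P ^ (-1 / β) := by
        rw [← ENNReal.mul_rpow_of_ne_top hmt hu1]
        exact ENNReal.rpow_le_rpow_of_nonpos hneg.le
          ((ENNReal.le_div_iff_mul_le (Or.inl hP) (Or.inl hu1)).1 hmP)
      have hvy : v y ^ (-1 / β) ≤ m ^ (-1 / β) * Q ^ (-1 / β) := by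
        rw [← ENNReal.mul_rpow_of_ne_top hmt hv1]
        exact ENNReal.rpow_le_rpow_of_nonpos hneg.le
          ((ENNReal.le_div_iff_mul_le (Or.inl hQ) (Or.inl hv1)).1 hmQ)
      have h1 : h (a * x + b * y) ^ (-1 / β) ≤ c * m ^ (-1 / β) := by
        calc _ ≤ _ := H x y
          _ ≤ A * (m ^ (-1 / β) * P ^ (-1 / β)) + B * (m ^ (-1 / β) * Q ^ (-1 / β)) := by gcongr
          _ = _ := by rw [hc]; ring
      have h2 := ENNReal.rpow_le_rpow_of_nonpos (neg_nonpos.2 hβ0.le) h1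
      have e1 : -1 / β * -β = 1 := by field_simp
      rw [ENNReal.mul_rpow_of_ne_top hct (ENNReal.rpow_ne_top_of_ne_zero hm0 hmt),
        ← ENNReal.rpow_mul, ← ENNReal.rpow_mul, e1, ENNReal.rpow_one, ENNReal.rpow_one, ENNReal.rpow_neg] at h2
      calc m = c ^ β * ((c ^ β)⁻¹ * m) := by
            rw [← mul_assoc, ENNReal.mul_inv_cancel hcβ0 hcβt, one_mul]
        _ ≤ _ := by gcongr)
  simp only [div_eq_mul_inv (u _), div_eq_mul_inv (v _)] at key
  rw [lintegral_mul_const _ hu, lintegral_mul_const _ hv, lintegral_const_mul _ hh,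
    ← div_eq_mul_inv, ← div_eq_mul_inv] at key
  have holder := ENNReal.add_mul_rpow_neg_le hβ hA hA' hB hB' hU hu2 hV hv2 hP hu1 hQ hv1
  have h3 : c ^ β * 1 ≤ c ^ β * ((∫⁻ x, h x) * D ^ (β - 1)) := by
    rw [mul_one, ← mul_assoc]
    exact holder.trans (mul_le_mul_left key _)
  have h4 : 1 ≤ (∫⁻ x, h x) * D ^ (β - 1) := (ENNReal.mul_le_mul_iff_right hcβ0 hcβt).1 h3
  have h5 : D ^ (-(β - 1)) ≤ ∫⁻ x, h x := by
    rw [ENNReal.rpow_neg, ← one_div]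
    exact ENNReal.div_le_of_le_mul h4
  calc _ ≤ (D ^ (-(β - 1))) ^ (-1 / (β - 1)) := ENNReal.rpow_le_rpow_of_nonpos hneg'.le h5
    _ = D := by
      rw [← ENNReal.rpow_mul]
      have : -(β - 1) * (-1 / (β - 1)) = 1 := by field_simp
      rw [this, ENNReal.rpow_one]

/-- The one-dimensional Borell–Brascamp–Lieb inequality. -/
theorem lintegral_rpow_le_one_dim {β : ℝ} (hβ : 1 < β) {a b : ℝ} (ha : 0 < a) (hb : 0 < b)
    {u v h : ℝ → ℝ≥0∞} (hu : Measurable u) (hv : Measurable v) (hh : Measurable h)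
    (H : ∀ x y, h (a * x + b * y) ^ (-1 / β) ≤
      ENNReal.ofReal a * u x ^ (-1 / β) + ENNReal.ofReal b * v y ^ (-1 / β)) :
    (∫⁻ x, h x) ^ (-1 / (β - 1)) ≤ ENNReal.ofReal a * (∫⁻ x, u x) ^ (-1 / (β - 1)) +
      ENNReal.ofReal b * (∫⁻ x, v x) ^ (-1 / (β - 1)) := by
  have hneg : -1 / β < 0 := div_neg_of_neg_of_pos (by norm_num) (by linarith)
  -- Truncation to the box `[-N, N] × [0, N]`.
  let T : (ℝ → ℝ≥0∞) → ℕ → ℝ → ℝ≥0∞ := fun w N =>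
    (Set.Icc (-N : ℝ) N).indicator fun x => min (w x) N
  have hTm : ∀ w, Measurable w → ∀ N, Measurable (T w N) := fun w hw N =>
    (hw.min measurable_const).indicator measurableSet_Icc
  have hTle : ∀ w N x, T w N x ≤ w x := fun w N x =>
    Set.indicator_apply_le' (fun _ => min_le_left _ _) fun _ => bot_le
  have hTN : ∀ w N x, T w N x ≤ N := fun w N x =>
    Set.indicator_apply_le' (fun _ => min_le_right _ _) fun _ => bot_le
  have hTsup : ∀ w N, ⨆ x, T w N x ≠ ∞ := fun w N =>
    ((iSup_le (hTN w N)).trans_lt (ENNReal.natCast_lt_top N)).ne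
  have hTint : ∀ w N, ∫⁻ x, T w N x ≠ ∞ := by
    intro w N
    rw [lintegral_indicator measurableSet_Icc]
    refine ((setLIntegral_mono measurable_const fun x _ => min_le_right _ _).trans_lt ?_).ne
    rw [setLIntegral_const, Real.volume_Icc]
    exact ENNReal.mul_lt_top (ENNReal.natCast_lt_top N) ENNReal.ofReal_lt_top
  have hTmono : ∀ w x, Monotone fun N => T w N x := by
    intro w x M N hMN
    have hMN' : (M : ℝ) ≤ N := by exact_mod_cast hMN
    refine Set.indicator_apply_le' (fun hx => ?_) fun _ => bot_le
    have hx' : x ∈ Set.Icc (-N : ℝ) N := ⟨by linarith [hx.1], by linarith [hx.2]⟩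
    simp only [T, Set.indicator_of_mem hx']
    exact min_le_min le_rfl (by exact_mod_cast hMN)
  have hTlim : ∀ w x, Filter.Tendsto (fun N => T w N x) Filter.atTop (nhds (w x)) := by
    intro w x
    have h1 : Filter.Tendsto (fun N : ℕ => min (w x) N) Filter.atTop (nhds (min (w x) ∞)) :=
      tendsto_const_nhds.min ENNReal.tendsto_nat_nhds_top
    rw [min_eq_left le_top] at h1
    refine h1.congr' ?_
    obtain ⟨N₀, hN₀⟩ := exists_nat_ge |x|
    filter_upwards [Filter.eventually_ge_atTop N₀] with N hN
    have h2 : |x| ≤ N := hN₀.trans (by exact_mod_cast hN)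
    have hx' : x ∈ Set.Icc (-N : ℝ) N := abs_le.1 h2
    simp only [T, Set.indicator_of_mem hx']
  have hTI : ∀ w, Measurable w →
      Filter.Tendsto (fun N => (∫⁻ x, T w N x) ^ (-1 / (β - 1))) Filter.atTop
        (nhds ((∫⁻ x, w x) ^ (-1 / (β - 1)))) := fun w hw =>
    (ENNReal.continuous_rpow_const.tendsto _).comp
      (lintegral_tendsto_of_tendsto_of_monotone (fun N => (hTm w hw N).aemeasurable)
        (Filter.Eventually.of_forall (hTmono w)) (Filter.Eventually.of_forall (hTlim w)))
  refine ge_of_tendsto' ((ENNReal.Tendsto.const_mul (hTI u hu) (Or.inr ENNReal.ofReal_ne_top)).add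
    (ENNReal.Tendsto.const_mul (hTI v hv) (Or.inr ENNReal.ofReal_ne_top))) fun N => ?_
  refine lintegral_rpow_le_of_bounded hβ ha hb (hTm u hu N) (hTm v hv N) hh (hTsup u N)
    (hTsup v N) (hTint u N) (hTint v N) fun x y => (H x y).trans ?_
  exact add_le_add
    (mul_le_mul' le_rfl (ENNReal.rpow_le_rpow_of_nonpos hneg.le (hTle u N x)))
    (mul_le_mul' le_rfl (ENNReal.rpow_le_rpow_of_nonpos hneg.le (hTle v N y)))

/-! ### The Borell–Brascamp–Lieb inequality in dimension `n` -/

theorem lintegral_fin_succ {n : ℕ} {w : (Fin (n + 1) → ℝ) → ℝ≥0∞} (hw : Measurable w) :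
    ∫⁻ x, w x = ∫⁻ s : ℝ, ∫⁻ y : Fin n → ℝ, w (Fin.cons s y) := by
  have e := (volume_preserving_piFinSuccAbove (fun _ : Fin (n + 1) => ℝ) 0).symm
  rw [← e.lintegral_comp hw]
  refine (lintegral_prod (μ := (volume : Measure ℝ)) (ν := (volume : Measure (Fin n → ℝ)))
    (fun p : ℝ × (Fin n → ℝ) => w ((MeasurableEquiv.piFinSuccAbove (fun _ : Fin (n + 1) => ℝ) 0).symm p))
    (hw.comp (MeasurableEquiv.measurable _)).aemeasurable).trans ?_
  simp [MeasurableEquiv.piFinSuccAbove, Fin.consEquiv]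

theorem measurable_cons_real {n : ℕ} :
    Measurable fun p : ℝ × (Fin n → ℝ) => (Fin.cons p.1 p.2 : Fin (n + 1) → ℝ) :=
  measurable_pi_iff.2 fun i => by
    refine Fin.cases ?_ (fun j => ?_) i
    · simpa using measurable_fst
    · simpa [Function.comp_def] using (measurable_pi_apply j).comp measurable_snd

/-- The Borell–Brascamp–Lieb inequality on `Fin n → ℝ`. In the induction step, integrating out the
last `n` coordinates lowers the exponent from `β` to `β - n`, and the marginals satisfy the
one-dimensional hypothesis with that exponent. -/
theorem lintegral_rpow_le_pi (n : ℕ) {a b : ℝ} (ha : 0 < a) (hb : 0 < b) :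
    ∀ {β : ℝ}, (n : ℝ) < β → ∀ {u v h : (Fin n → ℝ) → ℝ≥0∞}, Measurable u → Measurable v →
    Measurable h → (∀ x y, h (a • x + b • y) ^ (-1 / β) ≤
      ENNReal.ofReal a * u x ^ (-1 / β) + ENNReal.ofReal b * v y ^ (-1 / β)) →
    (∫⁻ x, h x) ^ (-1 / (β - n)) ≤ ENNReal.ofReal a * (∫⁻ x, u x) ^ (-1 / (β - n)) +
      ENNReal.ofReal b * (∫⁻ x, v x) ^ (-1 / (β - n)) := by
  induction n with
  | zero =>
    intro β _ u v h _ _ _ H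
    have e : ∀ w : (Fin 0 → ℝ) → ℝ≥0∞, ∫⁻ x, w x = w 0 := by
      intro w
      rw [lintegral_unique, volume_pi, Measure.pi_univ, Finset.univ_eq_empty, Finset.prod_empty,
        mul_one]
      exact congrArg w (Subsingleton.elim _ _)
    simpa [e] using H 0 0
  | succ n ih =>
    intro β hβ u v h hu hv hh H
    push_cast at hβ ⊢
    rw [lintegral_fin_succ hu, lintegral_fin_succ hv, lintegral_fin_succ hh]
    have hm : ∀ w : (Fin (n + 1) → ℝ) → ℝ≥0∞, Measurable w →
        Measurable fun s : ℝ => ∫⁻ y : Fin n → ℝ, w (Fin.cons s y) := fun w hw =>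
      (hw.comp measurable_cons_real).lintegral_prod_right'
    have hm' : ∀ w : (Fin (n + 1) → ℝ) → ℝ≥0∞, Measurable w → ∀ s : ℝ,
        Measurable fun y : Fin n → ℝ => w (Fin.cons s y) := fun w hw s =>
      (hw.comp measurable_cons_real).comp measurable_prodMk_left
    have key := lintegral_rpow_le_one_dim (β := β - n) (by linarith) ha hb (hm u hu) (hm v hv)
      (hm h hh) (fun s t => ih (by linarith) (hm' u hu s) (hm' v hv t) (hm' h hh _)
        fun x y => by
          refine le_of_eq_of_le ?_ (H (Fin.cons s x) (Fin.cons t y))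
          congr 2
          ext i
          refine Fin.cases ?_ (fun j => ?_) i <;> simp)
    rwa [sub_sub] at key

/-- The Borell–Brascamp–Lieb inequality on Euclidean space. The weights `a`, `b` need not sum to
one, and a function that vanishes at a point contributes `0 ^ (-1 / β) = ∞` there. -/
theorem lintegral_rpow_le_euclideanSpace {n : ℕ} {a b : ℝ} (ha : 0 < a) (hb : 0 < b) {β : ℝ}
    (hβ : (n : ℝ) < β) {u v h : EuclideanSpace ℝ (Fin n) → ℝ≥0∞} (hu : Measurable u)
    (hv : Measurable v) (hh : Measurable h) (H : ∀ x y, h (a • x + b • y) ^ (-1 / β) ≤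
      ENNReal.ofReal a * u x ^ (-1 / β) + ENNReal.ofReal b * v y ^ (-1 / β)) :
    (∫⁻ x, h x) ^ (-1 / (β - n)) ≤ ENNReal.ofReal a * (∫⁻ x, u x) ^ (-1 / (β - n)) +
      ENNReal.ofReal b * (∫⁻ x, v x) ^ (-1 / (β - n)) := by
  have e := PiLp.volume_preserving_toLp (Fin n)
  rw [← e.lintegral_comp hu, ← e.lintegral_comp hv, ← e.lintegral_comp hh]
  exact lintegral_rpow_le_pi n ha hb hβ (hu.comp e.measurable) (hv.comp e.measurable)
    (hh.comp e.measurable) fun x y => H _ _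

/-! ### Convex functions with an integrable negative power -/

theorem convexCost_nonneg {n : ℕ} {Ω : Set (EuclideanSpace ℝ (Fin n))}
    {V : EuclideanSpace ℝ (Fin n) → ℝ} (hV : ConvexOn ℝ Ω V) {x y : EuclideanSpace ℝ (Fin n)}
    (hx : x ∈ Ω) (hy : y ∈ Ω) (hd : DifferentiableAt ℝ V x) : 0 ≤ convexCost V x y := by
  have hc := hV.comp_affineMap (AffineMap.lineMap x y : ℝ →ᵃ[ℝ] EuclideanSpace ℝ (Fin n))
  have hg : HasFDerivAt V (InnerProductSpace.toDual ℝ _ (gradient V x))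
      ((AffineMap.lineMap x y : ℝ →ᵃ[ℝ] EuclideanSpace ℝ (Fin n)) 0) := by
    rw [AffineMap.lineMap_apply_zero]
    exact hd.hasGradientAt.hasFDerivAt
  have hder := hg.comp_hasDerivAt (0 : ℝ) AffineMap.hasDerivAt_lineMap
  have h := hc.le_slope_of_hasDerivAt (x := 0) (y := 1) (by simpa using hx) (by simpa using hy)
    one_pos hder
  simp only [slope_def_field, Function.comp_apply, AffineMap.lineMap_apply_zero,
    AffineMap.lineMap_apply_one, InnerProductSpace.toDual_apply_apply] at h
  unfold convexCost
  linarith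

/-- A positive convex function with `∫ V ^ (-β) < ∞` and `β > n` is bounded away from zero: around
a point where `V = ε`, convexity gives a set of volume of order `ε ^ n` on which `V` is of order
`ε`, which contributes at least a multiple of `ε ^ (n - β)` to the integral. -/
theorem ConvexOn.exists_pos_le_of_setLIntegral_ne_top {n : ℕ} {β : ℝ} (hβ : (n : ℝ) < β)
    {Ω : Set (EuclideanSpace ℝ (Fin n))} (hΩ : IsOpen Ω) (hne : Ω.Nonempty)
    {V : EuclideanSpace ℝ (Fin n) → ℝ} (hV_pos : ∀ x ∈ Ω, 0 < V x) (hV : ConvexOn ℝ Ω V)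
    (hVc : ContinuousOn V Ω) (hI : ∫⁻ x in Ω, ENNReal.ofReal (V x ^ (-β)) ≠ ∞) :
    ∃ m > 0, ∀ x ∈ Ω, m ≤ V x := by
  have hβ0 : 0 < β := lt_of_le_of_lt (Nat.cast_nonneg n) hβ
  obtain ⟨x₀, hx₀⟩ := hne
  set M := V x₀ + 1 with hM
  have hMpos : 0 < M := by linarith [hV_pos x₀ hx₀]
  obtain ⟨r, hr, hball⟩ : ∃ r > 0, ∀ y ∈ Metric.ball x₀ r, y ∈ Ω ∧ V y < M := by
    have h0 : ∀ᶠ y in nhds x₀, y ∈ Ω := hΩ.mem_nhds hx₀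
    have h1 : ∀ᶠ y in nhds x₀, y ∈ Ω ∧ V y < M :=
      h0.and <| (hVc.continuousAt (hΩ.mem_nhds hx₀)).eventually_lt
        continuousAt_const (by linarith)
    obtain ⟨r, hr, h⟩ := Metric.eventually_nhds_iff_ball.1 h1
    exact ⟨r, hr, h⟩
  set I := ∫⁻ x in Ω, ENNReal.ofReal (V x ^ (-β)) with hIdef
  set w := volume (Metric.ball (0 : EuclideanSpace ℝ (Fin n)) r) with hw
  have hw0 : w ≠ 0 := (Metric.measure_ball_pos volume _ hr).ne'
  have hwt : w ≠ ∞ := measure_ball_lt_top.ne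
  set K := I.toReal / w.toReal * (1 + M) ^ β + 1 with hK
  have hw0' : 0 < w.toReal := ENNReal.toReal_pos hw0 hwt
  have hKpos : 0 < K := by positivity
  refine ⟨min 1 (K ^ (-1 / (β - n))), lt_min one_pos (Real.rpow_pos_of_pos hKpos _), ?_⟩
  intro x hx
  rcases le_or_gt 1 (V x) with h1 | h1
  · exact (min_le_left _ _).trans h1
  refine (min_le_right _ _).trans ?_
  set ε := V x with hε
  have hεpos : 0 < ε := hV_pos x hx
  -- The ball about `x₀`, contracted towards `x` with ratio `V x`, carries too much mass
  -- when `V x` is small.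
  have hsub : ∀ z ∈ Metric.ball (x + ε • (x₀ - x)) (ε * r), z ∈ Ω ∧ V z ≤ ε * (1 + M) := by
    intro z hz
    set y := x + ε⁻¹ • (z - x) with hy
    have hzy : z = (1 - ε) • x + ε • y := by
      rw [hy, smul_add, smul_smul, mul_inv_cancel₀ hεpos.ne']
      module
    have hyb : y ∈ Metric.ball x₀ r := by
      rw [mem_ball_iff_norm] at hz ⊢
      have e : z - (x + ε • (x₀ - x)) = ε • (y - x₀) := by
        rw [hzy]; module
      rw [e, norm_smul, Real.norm_of_nonneg hεpos.le] at hz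
      exact lt_of_mul_lt_mul_left hz hεpos.le
    obtain ⟨hyΩ, hyM⟩ := hball y hyb
    rw [hzy]
    refine ⟨hV.1 hx hyΩ (by linarith) hεpos.le (by ring), ?_⟩
    have h2 := hV.2 hx hyΩ (sub_nonneg.2 h1.le) hεpos.le (by ring)
    simp only [smul_eq_mul] at h2
    nlinarith
  have h3 : ENNReal.ofReal ((ε * (1 + M)) ^ (-β)) * (ENNReal.ofReal (ε ^ n) * w) ≤ I := by
    have hvol : volume (Metric.ball (x + ε • (x₀ - x)) (ε * r)) = ENNReal.ofReal (ε ^ n) * w := by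
      rw [Measure.addHaar_ball_mul_of_pos _ _ hεpos, finrank_euclideanSpace_fin]
    rw [← hvol, ← setLIntegral_const]
    calc _ ≤ ∫⁻ z in Metric.ball (x + ε • (x₀ - x)) (ε * r), ENNReal.ofReal (V z ^ (-β)) := by
          refine setLIntegral_mono' Metric.isOpen_ball.measurableSet fun z hz => ?_
          exact ENNReal.ofReal_le_ofReal (Real.rpow_le_rpow_of_nonpos (hV_pos z (hsub z hz).1)
            (hsub z hz).2 (by linarith))
      _ ≤ I := lintegral_mono_set fun z hz => (hsub z hz).1
  have h4 := ENNReal.toReal_mono hI h3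
  rw [ENNReal.toReal_mul, ENNReal.toReal_mul, ENNReal.toReal_ofReal (by positivity),
    ENNReal.toReal_ofReal (by positivity), Real.mul_rpow hεpos.le (by linarith)] at h4
  have h5 : ε ^ (-(β - n)) ≤ K := by
    have e : ε ^ (-(β - n)) = ε ^ (-β) * ε ^ n := by
      rw [← Real.rpow_natCast, ← Real.rpow_add hεpos]; congr 1; ring
    have hMβ : 0 < (1 + M) ^ β := Real.rpow_pos_of_pos (by linarith) _
    rw [Real.rpow_neg (by linarith : (0:ℝ) ≤ 1 + M)] at h4
    have h6 : ε ^ (-β) * ε ^ n ≤ I.toReal / w.toReal * (1 + M) ^ β := by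
      rw [div_mul_eq_mul_div, le_div_iff₀ hw0']
      calc ε ^ (-β) * ε ^ n * w.toReal
          = (ε ^ (-β) * ((1 + M) ^ β)⁻¹ * (ε ^ n * w.toReal)) * (1 + M) ^ β := by
            field_simp
        _ ≤ _ := by gcongr
    rw [e]; linarith
  calc K ^ (-1 / (β - n)) ≤ (ε ^ (-(β - n))) ^ (-1 / (β - n)) :=
        Real.rpow_le_rpow_of_nonpos (Real.rpow_pos_of_pos hεpos _) h5
          (div_nonpos_of_nonpos_of_nonneg (by norm_num) (by linarith))
    _ = ε := by
      rw [← Real.rpow_mul hεpos.le]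
      have : -(β - n) * (-1 / (β - n)) = 1 := by
        have : β - n ≠ 0 := by linarith
        field_simp
      rw [this, Real.rpow_one]

/-! ### Differentiation at zero perturbation -/

theorem abs_one_add_rpow_neg_sub_one_le {β s : ℝ} (hβ : 0 < β) (hs : -(1 / 2) ≤ s) :
    |(1 + s) ^ (-β) - 1| ≤ β * (1 / 2) ^ (-β - 1) * |s| := by
  have h := (convex_Ici (-(1 / 2) : ℝ)).norm_image_sub_le_of_norm_hasDerivWithin_le
    (f := fun s : ℝ => (1 + s) ^ (-β)) (f' := fun s => 1 * (-β) * (1 + s) ^ (-β - 1))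
    (C := β * (1 / 2) ^ (-β - 1)) (x := 0) (y := s)
    (fun t ht => (((hasDerivAt_id t).const_add 1).rpow_const
      (Or.inl (by have : -(1 / 2) ≤ t := ht; simp only [id]; linarith))).hasDerivWithinAt)
    (fun t ht => by
      have ht' : -(1 / 2) ≤ t := ht
      have h0 : 0 ≤ (1 + t) ^ (-β - 1) := Real.rpow_nonneg (by linarith) _
      rw [norm_mul, Real.norm_of_nonneg h0, one_mul, norm_neg, Real.norm_of_nonneg hβ.le]
      exact mul_le_mul_of_nonneg_left
        (Real.rpow_le_rpow_of_nonpos (by norm_num) (by linarith) (by linarith)) hβ.le)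
    (by simp) hs
  simpa using h

/-- Only the derivative from the right is available: `F` may be unbounded above, so `1 + t * F` may
be negative for every `t < 0`. -/
theorem hasDerivWithinAt_integral_one_add_mul_rpow_neg {α : Type*} [MeasurableSpace α]
    {μ : Measure α} [IsProbabilityMeasure μ] {β k : ℝ} (hβ : 0 < β) {F : α → ℝ}
    (hF : Integrable F μ) (hk : 0 < k) (hFk : ∀ x, -k ≤ F x) :
    HasDerivWithinAt (fun t => ∫ x, (1 + t * F x) ^ (-β) ∂μ) (-β * ∫ x, F x ∂μ) (Set.Ioi 0) 0 ∧
      ∀ t ∈ Set.Ioo 0 (1 / (2 * k)), Integrable (fun x => (1 + t * F x) ^ (-β)) μ := by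
  have hlow : ∀ t ∈ Set.Ioo 0 (1 / (2 * k)), ∀ x, -(1 / 2) ≤ t * F x := by
    intro t ht x
    have h1 : t * k ≤ 1 / 2 := by
      have := mul_le_mul_of_nonneg_right ht.2.le hk.le
      have e : 1 / (2 * k) * k = 1 / 2 := by field_simp
      linarith
    nlinarith [mul_le_mul_of_nonneg_left (hFk x) ht.1.le]
  have hmeas : ∀ t : ℝ, AEStronglyMeasurable (fun x => (1 + t * F x) ^ (-β)) μ := fun t =>
    ((hF.aemeasurable.const_mul t).const_add 1).pow_const _ |>.aestronglyMeasurable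
  set C := β * (1 / 2 : ℝ) ^ (-β - 1) with hC
  have hint : ∀ t ∈ Set.Ioo 0 (1 / (2 * k)), Integrable (fun x => (1 + t * F x) ^ (-β)) μ := by
    intro t ht
    have h1 : Integrable (fun x => (1 + t * F x) ^ (-β) - 1) μ := by
      refine ((hF.const_mul t).abs.const_mul C).mono'
        ((hmeas t).sub aestronglyMeasurable_const) (Filter.Eventually.of_forall fun x => ?_)
      exact abs_one_add_rpow_neg_sub_one_le hβ (hlow t ht x)
    exact (h1.add (integrable_const (1 : ℝ))).congr
      (Filter.Eventually.of_forall fun x => by simp)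
  refine ⟨?_, hint⟩
  have hmem : Set.Ioo 0 (1 / (2 * k)) ∈ nhdsWithin (0 : ℝ) (Set.Ioi 0) :=
    Ioo_mem_nhdsGT (by positivity)
  rw [hasDerivWithinAt_iff_tendsto_slope' (by simp), ← integral_const_mul]
  have hDCT : Filter.Tendsto (fun t => ∫ x, t⁻¹ * ((1 + t * F x) ^ (-β) - 1) ∂μ)
      (nhdsWithin 0 (Set.Ioi 0)) (nhds (∫ x, -β * F x ∂μ)) := by
    refine tendsto_integral_filter_of_dominated_convergence (fun x => C * |F x|) ?_ ?_
      (hF.abs.const_mul C) ?_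
    · exact Filter.Eventually.of_forall fun t =>
        ((hmeas t).sub aestronglyMeasurable_const).const_mul _
    · filter_upwards [hmem] with t ht
      refine Filter.Eventually.of_forall fun x => ?_
      have h1 := abs_one_add_rpow_neg_sub_one_le hβ (hlow t ht x)
      rw [norm_mul, Real.norm_of_nonneg (inv_nonneg.2 ht.1.le), Real.norm_eq_abs]
      rw [abs_mul, abs_of_pos ht.1] at h1
      calc _ ≤ t⁻¹ * (C * (t * |F x|)) := by
            have := inv_nonneg.2 ht.1.le
            gcongr
        _ = _ := by have := ht.1.ne'; field_simp
    · refine Filter.Eventually.of_forall fun x => ?_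
      have h1 : HasDerivAt (fun t : ℝ => (1 + t * F x) ^ (-β))
          ((1 * F x) * (-β) * (1 + 0 * F x) ^ (-β - 1)) 0 :=
        (((hasDerivAt_id (0 : ℝ)).mul_const (F x)).const_add 1).rpow_const (Or.inl (by simp))
      have h2 := (hasDerivWithinAt_iff_tendsto_slope' (by simp)).1
        (h1.hasDerivWithinAt (s := Set.Ioi 0))
      simp only [one_mul, zero_mul, add_zero, Real.one_rpow, mul_one] at h2
      rw [mul_comm] at h2
      refine h2.congr fun t => ?_
      simp [slope]
  refine hDCT.congr' ?_
  filter_upwards [hmem] with t ht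
  rw [integral_const_mul, integral_sub (hint t ht) (integrable_const _)]
  simp [slope]

/-- The limit `t → 0⁺` of the perturbed inequality: both sides equal `1` at `t = 0`, and their right
derivatives are compared. -/
theorem one_add_mul_integral_le_of_lintegral_rpow_le {α : Type*} [MeasurableSpace α]
    {μ : Measure α} [IsProbabilityMeasure μ] {β γ k r : ℝ} (hβ : 0 < β) (hr : 0 ≤ r)
    {F : α → ℝ} (hF : Integrable F μ) (hk : 0 < k) (hFk : ∀ x, -k ≤ F x)
    (H : ∀ t ∈ Set.Ioo 0 (min 1 (1 / (2 * k))),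
      (∫⁻ x, ENNReal.ofReal ((1 + t * F x) ^ (-β)) ∂μ) ^ (-1 / γ) ≤
        ENNReal.ofReal (1 - t) + ENNReal.ofReal t * ENNReal.ofReal r) :
    1 + β / γ * ∫ x, F x ∂μ ≤ r := by
  obtain ⟨hder, hint⟩ := hasDerivWithinAt_integral_one_add_mul_rpow_neg hβ hF hk hFk
  have hφ0 : (∫ x, (1 + (0 : ℝ) * F x) ^ (-β) ∂μ) = 1 := by simp
  have h1 := hder.rpow_const (p := -1 / γ) (Or.inl (by rw [hφ0]; exact one_ne_zero))
  have h2 := (hasDerivWithinAt_iff_tendsto_slope' (by simp)).1 h1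
  have h3 : -β * (∫ x, F x ∂μ) * (-1 / γ) * (∫ x, (1 + (0 : ℝ) * F x) ^ (-β) ∂μ) ^ (-1 / γ - 1) ≤
      r - 1 := by
    refine le_of_tendsto h2 ?_
    filter_upwards [Ioo_mem_nhdsGT (show (0 : ℝ) < min 1 (1 / (2 * k)) by positivity)] with t ht
    have ht1 : t < 1 := ht.2.trans_le (min_le_left _ _)
    have htk : t ∈ Set.Ioo 0 (1 / (2 * k)) := ⟨ht.1, ht.2.trans_le (min_le_right _ _)⟩
    have hpos : ∀ x, 0 < 1 + t * F x := by
      intro x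
      have h1 : t * k < 1 := by
        have := mul_lt_mul_of_pos_right htk.2 hk
        have e : 1 / (2 * k) * k = 1 / 2 := by field_simp
        linarith
      nlinarith [mul_le_mul_of_nonneg_left (hFk x) ht.1.le]
    have hI : 0 < ∫ x, (1 + t * F x) ^ (-β) ∂μ := by
      rw [integral_pos_iff_support_of_nonneg
        (fun x => (Real.rpow_pos_of_pos (hpos x) _).le) (hint t htk)]
      have : Function.support (fun x => (1 + t * F x) ^ (-β)) = Set.univ :=
        Set.eq_univ_of_forall fun x => (Real.rpow_pos_of_pos (hpos x) _).ne'
      simp [this]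
    have h4 := H t ht
    rw [← ofReal_integral_eq_lintegral_ofReal (hint t htk)
      (Filter.Eventually.of_forall fun x => (Real.rpow_pos_of_pos (hpos x) _).le),
      ENNReal.ofReal_rpow_of_pos hI, ← ENNReal.ofReal_mul ht.1.le,
      ← ENNReal.ofReal_add (by linarith) (mul_nonneg ht.1.le hr),
      ENNReal.ofReal_le_ofReal_iff (by nlinarith [ht.1])] at h4
    rw [slope_def_field, hφ0, Real.one_rpow, sub_zero, div_le_iff₀ ht.1]
    linarith
  rw [hφ0, Real.one_rpow, mul_one] at h3
  have e : -β * (∫ x, F x ∂μ) * (-1 / γ) = β / γ * ∫ x, F x ∂μ := by ring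
  linarith

/-! ### The inequality on subsets of the domain, and the limit -/

/-- An almost everywhere measurable function that is bounded below has a measurable version that
lies below it everywhere, not only almost everywhere. -/
theorem AEMeasurable.exists_measurable_le {α : Type*} [MeasurableSpace α] {μ : Measure α}
    {f : α → ℝ} (hf : AEMeasurable f μ) {c : ℝ} (hc : ∀ x, c ≤ f x) :
    ∃ F : α → ℝ, Measurable F ∧ (∀ x, c ≤ F x) ∧ (∀ x, F x ≤ f x) ∧ F =ᵐ[μ] f := by
  classical
  set N := toMeasurable μ {x | f x ≠ hf.mk f x} with hN
  have hN0 : μ N = 0 := by rw [measure_toMeasurable]; exact hf.ae_eq_mk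
  have hout : ∀ x, x ∉ N → hf.mk f x = f x := by
    intro x hx
    by_contra h
    exact hx (subset_toMeasurable _ _ (Ne.symm h))
  refine ⟨N.piecewise (fun _ => c) (hf.mk f),
    Measurable.piecewise (measurableSet_toMeasurable _ _) measurable_const hf.measurable_mk,
    fun x => ?_, fun x => ?_, ?_⟩
  · by_cases hx : x ∈ N
    · simp [hx]
    · simpa [hx, hout x hx] using hc x
  · by_cases hx : x ∈ N
    · simpa [hx] using hc x
    · simp [hx, hout x hx]
  · filter_upwards [measure_eq_zero_iff_ae_notMem.1 hN0] with x hx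
    simp [hx, hout x hx]

theorem indicator_rpow_neg_rpow {α : Type*} {β : ℝ} (hβ : 0 < β) (S : Set α) (A : α → ℝ≥0∞)
    [DecidablePred (· ∈ S)] (x : α) :
    (S.indicator (fun y => A y ^ (-β)) x) ^ (-1 / β) = if x ∈ S then A x else ∞ := by
  split_ifs with hx
  · rw [Set.indicator_of_mem hx, ← ENNReal.rpow_mul]
    have : -β * (-1 / β) = 1 := by field_simp
    rw [this, ENNReal.rpow_one]
  · rw [Set.indicator_of_notMem hx]
    exact ENNReal.zero_rpow_of_neg (div_neg_of_neg_of_pos (by norm_num) hβ)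

theorem lintegral_powerDensityMeasure {n : ℕ} {β : ℝ} {Ω : Set (EuclideanSpace ℝ (Fin n))}
    (hΩ : IsOpen Ω) {V : EuclideanSpace ℝ (Fin n) → ℝ} (hV_pos : ∀ x ∈ Ω, 0 < V x)
    (hVc : ContinuousOn V Ω) (G : EuclideanSpace ℝ (Fin n) → ℝ≥0∞) :
    ∫⁻ x, G x ∂(powerDensityMeasure Ω V β) =
      ∫⁻ x, Ω.indicator (fun x => ENNReal.ofReal (V x) ^ (-β) * G x) x := by
  have hm : AEMeasurable V (volume.restrict Ω) := hVc.aemeasurable hΩ.measurableSet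
  rw [powerDensityMeasure, lintegral_withDensity_eq_lintegral_mul_non_measurable₀ _
    (hm.pow_const _).ennreal_ofReal (Filter.Eventually.of_forall fun _ => ENNReal.ofReal_lt_top),
    lintegral_indicator hΩ.measurableSet]
  refine setLIntegral_congr_fun hΩ.measurableSet fun x hx => ?_
  simp [ENNReal.ofReal_rpow_of_pos (hV_pos x hx)]

/-- The inequality when the second variable is confined to `S ⊆ Ω`, for a function `F` that is
bounded below. The Borell–Brascamp–Lieb inequality is applied, for small `t > 0`, to `V ^ (-β)`,
to `((1 + g) V) ^ (-β)` on `S`, and to `(V (1 + t F)) ^ (-β)`. -/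
theorem one_add_mul_integral_le_of_subset {n : ℕ} {β : ℝ} (hβ : (n : ℝ) < β)
    {Ω S : Set (EuclideanSpace ℝ (Fin n))} (hΩ : IsOpen Ω) (hS : S ⊆ Ω)
    {V : EuclideanSpace ℝ (Fin n) → ℝ} (hV_pos : ∀ x ∈ Ω, 0 < V x) (hV : ConvexOn ℝ Ω V)
    (hV_diff : DifferentiableOn ℝ V Ω) [IsProbabilityMeasure (powerDensityMeasure Ω V β)]
    {F g : EuclideanSpace ℝ (Fin n) → ℝ} {k r : ℝ} (hF : Measurable F) (hk : 0 < k)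
    (hFk : ∀ x, -k ≤ F x) (hFi : Integrable F (powerDensityMeasure Ω V β))
    (hg : ∀ y ∈ Ω, -1 ≤ g y)
    (hFg : ∀ x ∈ Ω, ∀ y ∈ S, F x * V x ≤ g y * V y + convexCost V x y) (hr : 0 ≤ r)
    (hSr : (∫⁻ y, S.indicator (fun y => ENNReal.ofReal (1 + g y) ^ (-β)) y
      ∂(powerDensityMeasure Ω V β)) ^ (-1 / (β - n)) = ENNReal.ofReal r) :
    1 + β / (β - n) * ∫ x, F x ∂(powerDensityMeasure Ω V β) ≤ r := by
  classical
  have hβ0 : 0 < β := lt_of_le_of_lt (Nat.cast_nonneg n) hβ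
  have hneg : -1 / β < 0 := div_neg_of_neg_of_pos (by norm_num) hβ0
  have hVc := hV_diff.continuousOn
  refine one_add_mul_integral_le_of_lintegral_rpow_le hβ0 hr hFi hk hFk fun t ht => ?_
  have ht0 : 0 < t := ht.1
  have ht1 : t < 1 := ht.2.trans_le (min_le_left _ _)
  have htk : t < 1 / (2 * k) := ht.2.trans_le (min_le_right _ _)
  have hpos : ∀ x, 0 < 1 + t * F x := by
    intro x
    have h1 : t * k < 1 := by
      have := mul_lt_mul_of_pos_right htk hk
      have e : 1 / (2 * k) * k = 1 / 2 := by field_simp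
      linarith
    nlinarith [mul_le_mul_of_nonneg_left (hFk x) ht0.le]
  -- A measurable function on the whole space that agrees with `V` on `Ω`.
  set V₀ := Ω.piecewise V 0 with hV₀
  have hV₀m : Measurable V₀ :=
    ContinuousOn.measurable_piecewise hVc continuousOn_const hΩ.measurableSet
  have hV₀V : ∀ x ∈ Ω, V₀ x = V x := fun x hx => Set.piecewise_eq_of_mem _ _ _ hx
  set u := Ω.indicator fun x => ENNReal.ofReal (V₀ x) ^ (-β) with hu
  set h := Ω.indicator fun x => ENNReal.ofReal (V₀ x * (1 + t * F x)) ^ (-β) with hh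
  have hum : Measurable u := (hV₀m.ennreal_ofReal.pow_const _).indicator hΩ.measurableSet
  have hhm : Measurable h :=
    ((hV₀m.mul ((hF.const_mul t).const_add 1)).ennreal_ofReal.pow_const _).indicator
      hΩ.measurableSet
  obtain ⟨v, hvm, hvle, hvint⟩ := exists_measurable_le_lintegral_eq (μ := volume)
    (S.indicator fun y => ENNReal.ofReal ((1 + g y) * V y) ^ (-β))
  have hBBL := lintegral_rpow_le_euclideanSpace (a := 1 - t) (b := t) (by linarith) ht0 hβ hum hvm
    hhm (by
      intro x y
      have hv' := ENNReal.rpow_le_rpow_of_nonpos hneg.le (hvle y)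
      rw [indicator_rpow_neg_rpow hβ0] at hv'
      refine le_trans ?_ (add_le_add le_rfl (mul_le_mul' le_rfl hv'))
      rw [hu, hh, indicator_rpow_neg_rpow hβ0, indicator_rpow_neg_rpow hβ0]
      by_cases hx : x ∈ Ω
      swap
      · have : ENNReal.ofReal (1 - t) ≠ 0 := by simpa using ht1
        simp [hx, ENNReal.mul_top this]
      by_cases hy : y ∈ S
      swap
      · have : ENNReal.ofReal t ≠ 0 := by simpa using ht0
        simp [hy, ENNReal.mul_top this]
      have hyΩ := hS hy
      have hz : (1 - t) • x + t • y ∈ Ω := hV.1 hx hyΩ (by linarith) ht0.le (by ring)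
      rw [if_pos hx, if_pos hy, if_pos hz, hV₀V _ hx, hV₀V _ hz,
        ← ENNReal.ofReal_mul (by linarith), ← ENNReal.ofReal_mul ht0.le,
        ← ENNReal.ofReal_add (mul_nonneg (by linarith) (hV_pos x hx).le)
          (mul_nonneg ht0.le (mul_nonneg (by linarith [hg y hyΩ]) (hV_pos y hyΩ).le))]
      refine ENNReal.ofReal_le_ofReal ?_
      -- The convexity bound at `x` and the hypothesis at `y` are both taken with the tangent
      -- plane at `z = (1 - t) x + t y`, so that the gradient terms cancel.
      set z := (1 - t) • x + t • y with hzdef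
      have h1 := convexCost_nonneg hV hz hx (hV_diff.differentiableAt (hΩ.mem_nhds hz))
      have h2 := hFg z hz y hy
      have h3 : (1 - t) * inner ℝ (gradient V z) (x - z) + t * inner ℝ (gradient V z) (y - z)
          = 0 := by
        rw [← real_inner_smul_right, ← real_inner_smul_right, ← inner_add_right]
        have : (1 - t) • (x - z) + t • (y - z) = 0 := by rw [hzdef]; module
        rw [this, inner_zero_right]
      unfold convexCost at h1 h2
      have h4 := mul_le_mul_of_nonneg_left h2 ht0.le
      have h5 := mul_nonneg (by linarith : 0 ≤ 1 - t) h1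
      nlinarith)
  have hu1 : ∫⁻ x, u x = 1 := by
    have h1 := lintegral_powerDensityMeasure (β := β) hΩ hV_pos hVc (fun _ => 1)
    rw [lintegral_one, measure_univ] at h1
    rw [h1]
    refine lintegral_congr fun x => ?_
    by_cases hx : x ∈ Ω <;> simp [hu, hx, hV₀V]
  have hh1 : ∫⁻ x, h x =
      ∫⁻ x, ENNReal.ofReal ((1 + t * F x) ^ (-β)) ∂(powerDensityMeasure Ω V β) := by
    rw [lintegral_powerDensityMeasure hΩ hV_pos hVc]
    refine lintegral_congr fun x => ?_
    by_cases hx : x ∈ Ω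
    · rw [hh, Set.indicator_of_mem hx, Set.indicator_of_mem hx, hV₀V x hx,
        ENNReal.ofReal_mul (hV_pos x hx).le,
        ENNReal.mul_rpow_of_ne_top ENNReal.ofReal_ne_top ENNReal.ofReal_ne_top,
        ENNReal.ofReal_rpow_of_pos (hpos x)]
    · simp [hh, hx]
  have hv1 : ∫⁻ x, v x = ∫⁻ y, S.indicator (fun y => ENNReal.ofReal (1 + g y) ^ (-β)) y
      ∂(powerDensityMeasure Ω V β) := by
    rw [← hvint, lintegral_powerDensityMeasure hΩ hV_pos hVc]
    refine lintegral_congr fun x => ?_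
    by_cases hx : x ∈ S
    · rw [Set.indicator_of_mem hx, Set.indicator_of_mem (hS hx), Set.indicator_of_mem hx, mul_comm,
        ENNReal.ofReal_mul (hV_pos x (hS hx)).le,
        ENNReal.mul_rpow_of_ne_top ENNReal.ofReal_ne_top ENNReal.ofReal_ne_top]
    · by_cases hxΩ : x ∈ Ω <;> simp [hx, hxΩ]
  rwa [hu1, hh1, hv1, hSr, ENNReal.one_rpow, mul_one] at hBBL

theorem theorem2p1 (n : ℕ) (β : ℝ) (hβ : (n : ℝ) < β)
    (Ω : Set (EuclideanSpace ℝ (Fin n))) (hΩ_open : IsOpen Ω)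
    (V : EuclideanSpace ℝ (Fin n) → ℝ) (hV_pos : ∀ x ∈ Ω, 0 < V x)
    (hV_convex : ConvexOn ℝ Ω V) (hV_diff : DifferentiableOn ℝ V Ω)
    (hV_prob : IsProbabilityMeasure (powerDensityMeasure Ω V β))
    (f g : EuclideanSpace ℝ (Fin n) → ℝ)
    (hf_meas : AEMeasurable f (volume.restrict Ω))
    (hg_meas : AEMeasurable g (volume.restrict Ω))
    (hfg : ∀ x ∈ Ω, ∀ y ∈ Ω, f x * V x ≤ g y * V y + convexCost V x y)
    (hf_int : Integrable f (powerDensityMeasure Ω V β))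
    (hg_ge : ∀ y ∈ Ω, -1 ≤ g y) :
    ((1 + β / (β - n) * ∫ x, f x ∂(powerDensityMeasure Ω V β) : ℝ) : EReal) ≤
      (((∫⁻ y, ENNReal.ofReal (1 + g y) ^ (-β) ∂(powerDensityMeasure Ω V β)) ^
        (-1 / (β - n)) : ℝ≥0∞) : EReal) := by
  classical
  have hβ0 : 0 < β := lt_of_le_of_lt (Nat.cast_nonneg n) hβ
  have hVc := hV_diff.continuousOn
  set μ := powerDensityMeasure Ω V β with hμ
  have hac : μ ≪ volume.restrict Ω := withDensity_absolutelyContinuous _ _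
  have hΩae : ∀ᵐ x ∂μ, x ∈ Ω := hac.ae_le (ae_restrict_mem hΩ_open.measurableSet)
  have hmass : ∫⁻ x in Ω, ENNReal.ofReal (V x ^ (-β)) = 1 := by
    have h1 : μ Set.univ = 1 := measure_univ
    rwa [hμ, powerDensityMeasure, withDensity_apply _ MeasurableSet.univ,
      Measure.restrict_univ] at h1
  have hne : Ω.Nonempty := by
    obtain ⟨x, hx⟩ := hΩae.exists
    exact ⟨x, hx⟩
  obtain ⟨m, hm, hmV⟩ := hV_convex.exists_pos_le_of_setLIntegral_ne_top hβ hΩ_open hne hV_pos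
    hVc (by rw [hmass]; exact ENNReal.one_ne_top)
  set G : EuclideanSpace ℝ (Fin n) → ℝ≥0∞ := fun y => ENNReal.ofReal (1 + g y) ^ (-β) with hG
  set S : ℕ → Set (EuclideanSpace ℝ (Fin n)) := fun j => {y | y ∈ Ω ∧ V y ≤ j} with hS
  have hlevel : ∀ j : ℕ, ENNReal.ofReal (1 + β / (β - n) * ∫ x, f x ∂μ) ≤
      (∫⁻ y, (S j).indicator G y ∂μ) ^ (-1 / (β - n)) := by
    intro j
    rcases eq_or_ne ((∫⁻ y, (S j).indicator G y ∂μ) ^ (-1 / (β - n))) ∞ with hR | hR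
    · rw [hR]; exact le_top
    set k : ℝ := j / m + 1 with hk
    have hkpos : 0 < k := by positivity
    have hmaxi : Integrable (fun x => max (f x) (-k)) μ := hf_int.sup (integrable_const _)
    obtain ⟨F, hFm, hFk, hFle, hFae⟩ := AEMeasurable.exists_measurable_le
      (hf_meas.max aemeasurable_const) (c := -k) fun x => le_max_right _ _
    have hFaeμ := hac.ae_le hFae
    have hFi : Integrable F μ := hmaxi.congr (Filter.EventuallyEq.symm hFaeμ)
    have hle : ∫ x, f x ∂μ ≤ ∫ x, F x ∂μ := by
      refine integral_mono_ae hf_int hFi ?_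
      filter_upwards [hFaeμ] with x hx
      rw [hx]
      exact le_max_left _ _
    have h1 := one_add_mul_integral_le_of_subset hβ hΩ_open (S := S j) (fun y hy => hy.1) hV_pos
      hV_convex hV_diff hFm hkpos hFk hFi hg_ge (by
        intro x hx y hy
        refine (mul_le_mul_of_nonneg_right (hFle x) (hV_pos x hx).le).trans ?_
        rcases max_choice (f x) (-k) with hmax | hmax
        · rw [hmax]
          exact hfg x hx y hy.1
        · -- Here `k V(x) ≥ j ≥ V(y)`, while `g V ≥ -V` and `d_V ≥ 0`.
          rw [hmax]
          have h2 := convexCost_nonneg hV_convex hx hy.1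
            (hV_diff.differentiableAt (hΩ_open.mem_nhds hx))
          have h3 : (j : ℝ) ≤ k * V x := by
            calc (j : ℝ) = j / m * m := by field_simp
              _ ≤ k * V x := mul_le_mul (by linarith) (hmV x hx) hm.le hkpos.le
          have h4 := mul_le_mul_of_nonneg_right (hg_ge y hy.1) (hV_pos y hy.1).le
          linarith [hy.2]) ENNReal.toReal_nonneg (ENNReal.ofReal_toReal hR).symm
    rw [← ENNReal.ofReal_toReal hR]
    refine ENNReal.ofReal_le_ofReal (le_trans ?_ h1)
    have : 0 ≤ β / (β - n) := div_nonneg hβ0.le (by linarith)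
    gcongr
  have hlim : Filter.Tendsto (fun j => (∫⁻ y, (S j).indicator G y ∂μ) ^ (-1 / (β - n)))
      Filter.atTop (nhds ((∫⁻ y, G y ∂μ) ^ (-1 / (β - n)))) := by
    refine (ENNReal.continuous_rpow_const.tendsto _).comp
      (lintegral_tendsto_of_tendsto_of_monotone (fun j => ?_) ?_ ?_)
    · have hSm : MeasurableSet (S j) := by
        have h1 : Measurable (Ω.piecewise V 0) :=
          ContinuousOn.measurable_piecewise hVc continuousOn_const hΩ_open.measurableSet
        have h2 : S j = Ω ∩ (Ω.piecewise V 0) ⁻¹' Set.Iic (j : ℝ) := by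
          ext y
          simp only [hS, Set.mem_ofPred_eq, Set.mem_inter_iff, Set.mem_preimage, Set.mem_Iic]
          refine and_congr_right fun hy => ?_
          rw [Set.piecewise_eq_of_mem _ _ _ hy]
        rw [h2]
        exact hΩ_open.measurableSet.inter (h1 measurableSet_Iic)
      exact ((((hg_meas.mono_ac hac).const_add 1).ennreal_ofReal).pow_const _).indicator hSm
    · refine Filter.Eventually.of_forall fun y i j hij => ?_
      have hij' : (i : ℝ) ≤ j := by exact_mod_cast hij
      have hsub : S i ⊆ S j := fun z hz => ⟨hz.1, hz.2.trans hij'⟩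
      exact Set.indicator_le_indicator_of_subset hsub (fun _ => bot_le) y
    · filter_upwards [hΩae] with y hy
      obtain ⟨N, hN⟩ := exists_nat_ge (V y)
      refine tendsto_const_nhds.congr' ?_
      filter_upwards [Filter.eventually_ge_atTop N] with j hj
      have : y ∈ S j := ⟨hy, hN.trans (by exact_mod_cast hj)⟩
      rw [Set.indicator_of_mem this]
  have hfinal := ge_of_tendsto' hlim hlevel
  calc _ ≤ ((ENNReal.ofReal (1 + β / (β - n) * ∫ x, f x ∂μ) : ℝ≥0∞) : EReal) := by
        rw [EReal.coe_ennreal_ofReal]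
        exact_mod_cast le_max_left _ _
    _ ≤ _ := EReal.coe_ennreal_le_coe_ennreal_iff.2 hfinal
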